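/- **Theorem.** There is a universal constant $c>0$ such that for all integers $n,m\ge 0$, every set $S$, every relation $f\subseteq\{0,1\}^n\times S$ and every partial Boolean function $g\subseteq\{0,1\}^m\times\{0,1\}$, $$R_{1/3}(f\circ g^n)\;\ge\; c\cdot R_{4/9}(f)\cdot\bar\chi(g).$$ Here the notions are as follows. *Query complexity.* A deterministic query algorithm is a binary decision tree which queries bits of its input and outputs the label of the leaf it reaches; a randomized query algorithm is a probability distribution over deterministic ones. For a relation $h\subseteq\{0,1\}^k\times S$, a randomized query algorithm $\mathcal A$ computes $h$ with error $\epsilon$ if $\Pr[(x,\mathcal A(x))\in h]\ge 1-\epsilon$ for all $x\in\{0,1\}^k$, and $R_\epsilon(h)$ is the minimum, over all such $\mathcal A$, of the maximal number of queries over all inputs and all internal randomness ($\infty$ if there is no such $\mathcal A$). A deterministic tree $T$ computes $h$ if $(x,T(x))\in h$ for all $x$. *Partial functions and composition.* For $g\subseteq\{0,1\}^m\times\{0,1\}$ let $g^{-1}(b)$ be the set of $x$ with $(x,b)\in g$ and $(x,\bar b)\notin g$. The strings in $g^{-1}(0)\cup g^{-1}(1)$ are the valid inputs; for these $g(x)$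 denotes the unique $b$ with $(x,b)\in g$. $g$ is a partial Boolean function if $(y,0),(y,1)\in g$ for every $y$ which is not valid. For $x=(x_1,\dots,x_n)\in(\{0,1\}^m)^n$ and $s\in S$, $(x,s)\in f\circ g^n$ iff some $x_i$ is not valid, or all $x_i$ are valid and $((g(x_1),\dots,g(x_n)),s)\in f$. *Max conflict complexity.* Let $\mu_0,\mu_1$ be probability distributions supported in $g^{-1}(0)$ and $g^{-1}(1)$, and let $T$ be a deterministic tree computing $g$. For an inner vertex $v$ of $T$ querying the index $q(v)$, let $d(v)$ be its depth (the root has depth $1$), let $p_b(v)=\Pr_{x\sim\mu_b}[x_{q(v)}=0\mid x\text{ reaches }v]$, and $\Delta(v)=|p_0(v)-p_1(v)|$. Let $R(v)=1$ for the root, and for a child $v$ of $w$ let $R(v)=R(w)\cdot\min_{b}\Pr_{x\sim\mu_b}[x\text{ reaches }v\mid x\text{ reaches }w]$ (vertices that are reached with probability $0$ under $\mu_0$ or $\mu_1$ have $R(v)=0$). Put $\chi(T,(\mu_0,\mu_1))=\sum_v d(v)\,\Delta(v)\,R(v)$, where $v$ ranges over the inner vertices of $T$. Then $$\bar\chi(g)=\max_{\mathcal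 Q}\;\min_T\;\mathbb E_{(\mu_0,\mu_1)\sim\mathcal Q}\big[\chi(T,(\mu_0,\mu_1))\big],$$ where $\mathcal Q$ ranges over the (discrete) probability distributions over pairs $(\mu_0,\mu_1)$ such that $\mathrm{supp}(\mu_0)\subseteq g^{-1}(0)$ and $\mathrm{supp}(\mu_1)\subseteq g^{-1}(1)$ for each pair in the support of $\mathcal Q$, and $T$ ranges over the deterministic trees computing $g$ (if $g^{-1}(0)$ or $g^{-1}(1)$ is empty, no $\mathcal Q$ exists, and $\bar\chi(g)=0$; conventionally $0\cdot\infty=0$). -/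

import Mathlib

open scoped ENNReal

namespace QueryComplexity

/-- Deterministic query algorithms (binary decision trees) on inputs `x : ι → Bool` with outputs
in `S`. At an inner vertex `query i t₀ t₁` the bit `x i` is queried and the computation goes on
with `t₀` on answer `0` (`false`) and with `t₁` on answer `1` (`true`). -/
inductive DecisionTree (ι : Type*) (S : Type*) where
  | leaf (s : S) : DecisionTree ι S
  | query (i : ι) (t₀ t₁ : DecisionTree ι S) : DecisionTree ι S

namespace DecisionTree

variable {ι S : Type*}

/-- The output of the tree on input `x`. -/
def output : DecisionTree ι S → (ι → Bool) → S
  | leaf s, _ => s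
  | query i t₀ t₁, x => if x i then t₁.output x else t₀.output x

/-- The number of queries that the tree makes on input `x`. -/
def numQueries : DecisionTree ι S → (ι → Bool) → ℕ
  | leaf _, _ => 0
  | query i t₀ t₁, x => (if x i then t₁.numQueries x else t₀.numQueries x) + 1

/-- The tree computes the relation `h`. -/
def Computes (T : DecisionTree ι S) (h : Set ((ι → Bool) × S)) : Prop :=
  ∀ x, (x, T.output x) ∈ h

end DecisionTree

/-- A randomized query algorithm is a probability distribution over deterministic ones. -/
abbrev RandomizedAlgorithm (ι S : Type*) := PMF (DecisionTree ι S)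

/-- The randomized algorithm `A` computes `h` with error `ε`:
on every input `x` its output is correct with probability at least `1 - ε`. -/
def ComputesWithError {ι S : Type*} (A : RandomizedAlgorithm ι S) (h : Set ((ι → Bool) × S))
    (ε : ℝ) : Prop :=
  ∀ x : ι → Bool, ENNReal.ofReal (1 - ε) ≤ A.toOuterMeasure {T | (x, T.output x) ∈ h}

/-- The bounded-error randomized query complexity `R_ε(h)`: the minimum, over all randomized query
algorithms computing `h` with error `ε`, of the maximal number of queries over all inputs and all
outcomes of the internal randomness. It is `⊤` if no such algorithm exists, which
for `0 ≤ ε < 1` happens exactly when some input has no correct output. -/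
noncomputable def randQueryComplexity {ι S : Type*} (ε : ℝ) (h : Set ((ι → Bool) × S)) : ℕ∞ :=
  sInf {q : ℕ∞ | ∃ A : RandomizedAlgorithm ι S, ComputesWithError A h ε ∧
    ∀ T ∈ A.support, ∀ x, (T.numQueries x : ℕ∞) ≤ q}

/-- For a relation `g ⊆ {0,1}^m × {0,1}`, the set `g⁻¹(b)` of the strings `x` with
`(x, b) ∈ g` and `(x, 1 - b) ∉ g`. -/
def preim {m : ℕ} (g : Set ((Fin m → Bool) × Bool)) (b : Bool) : Set (Fin m → Bool) :=
  {x | (x, b) ∈ g ∧ (x, !b) ∉ g}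

/-- The valid inputs `g⁻¹(0) ∪ g⁻¹(1)`. -/
def validInputs {m : ℕ} (g : Set ((Fin m → Bool) × Bool)) : Set (Fin m → Bool) :=
  preim g false ∪ preim g true

/-- A partial Boolean function, as a relation: both outputs are allowed on every string which is
not a valid input. -/
def IsPartialBooleanFunction {m : ℕ} (g : Set ((Fin m → Bool) × Bool)) : Prop :=
  ∀ y, y ∉ validInputs g → (y, false) ∈ g ∧ (y, true) ∈ g

/-- The `i`-th block `x_i ∈ {0,1}^m` of `x ∈ ({0,1}^m)^n`. -/
def block {n m : ℕ} (x : Fin n × Fin m → Bool) (i : Fin n) : Fin m → Bool :=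
  fun j => x (i, j)

/-- The composition `f ∘ g^n`. In the second alternative `z` is the string
`(g(x_1), …, g(x_n))`. -/
def compose {n m : ℕ} {S : Type*} (f : Set ((Fin n → Bool) × S))
    (g : Set ((Fin m → Bool) × Bool)) : Set ((Fin n × Fin m → Bool) × S) :=
  {p | (∃ i, block p.1 i ∉ validInputs g) ∨
    ∃ z : Fin n → Bool, (∀ i, block p.1 i ∈ preim g (z i)) ∧ (z, p.2) ∈ f}

/-- `Pr_{x ∼ μ}[x_i = b | x ∈ C]` (with value `0` if `C` has probability `0`). -/
noncomputable def condProb {m : ℕ} (μ : PMF (Fin m → Bool)) (C : Set (Fin m → Bool))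
    (i : Fin m) (b : Bool) : ℝ :=
  (μ.toOuterMeasure {x | x ∈ C ∧ x i = b} / μ.toOuterMeasure C).toReal

/-- The sum of `d(v) * Δ(v) * R(v)` over the inner vertices `v` of a subtree whose root `w` has
subcube `C` (the inputs that reach `w`), depth `d(w) = d` and `R(w) = r`. Here
`Δ(v) = |p_0(v) - p_1(v)|`, and `R` of the child of `v` on answer `b` is `R(v)` times the smaller
one of the probabilities under `μ₀` and `μ₁` of answer `b` conditioned on reaching `v`.
A vertex that has probability `0` under `μ₀` or `μ₁` has `R(v) = 0`, so the value of `condProb` for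
conditions of probability `0` plays no role. -/
noncomputable def conflictSum {m : ℕ} (μ₀ μ₁ : PMF (Fin m → Bool)) :
    DecisionTree (Fin m) Bool → Set (Fin m → Bool) → ℕ → ℝ → ℝ
  | .leaf _, _, _, _ => 0
  | .query i t₀ t₁, C, d, r =>
      d * |condProb μ₀ C i false - condProb μ₁ C i false| * r
        + conflictSum μ₀ μ₁ t₀ {x | x ∈ C ∧ x i = false} (d + 1)
            (r * min (condProb μ₀ C i false) (condProb μ₁ C i false))
        + conflictSum μ₀ μ₁ t₁ {x | x ∈ C ∧ x i = true} (d + 1)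
            (r * min (condProb μ₀ C i true) (condProb μ₁ C i true))

/-- `χ(T, (μ₀, μ₁)) = ∑_v d(v) * Δ(v) * R(v)`; the root has depth `1` and `R = 1`. -/
noncomputable def conflict {m : ℕ} (T : DecisionTree (Fin m) Bool)
    (μ₀ μ₁ : PMF (Fin m → Bool)) : ℝ :=
  conflictSum μ₀ μ₁ T Set.univ 1 1

/-- The expectation `χ(T, Q)` of `χ(T, (μ₀, μ₁))` over a pair `(μ₀, μ₁)` drawn from `Q`. -/
noncomputable def conflictExp {m : ℕ} (T : DecisionTree (Fin m) Bool)
    (Q : PMF (PMF (Fin m → Bool) × PMF (Fin m → Bool))) : ℝ≥0∞ :=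
  ∑' p, Q p * ENNReal.ofReal (conflict T p.1 p.2)

/-- `Q` is consistent with `g`: for each pair `(μ₀, μ₁)` in the support of `Q`, the supports of
`μ₀` and `μ₁` are contained in `g⁻¹(0)` and `g⁻¹(1)`. -/
def Consistent {m : ℕ} (g : Set ((Fin m → Bool) × Bool))
    (Q : PMF (PMF (Fin m → Bool) × PMF (Fin m → Bool))) : Prop :=
  ∀ p ∈ Q.support, p.1.support ⊆ preim g false ∧ p.2.support ⊆ preim g true

/-- The max conflict complexity of `g`: the maximum over all distributions `Q` over pairs of
distributions, consistent with `g`, of the minimum of `χ(T, Q)` over the deterministic trees `T`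
computing `g`. -/
noncomputable def maxConflict {m : ℕ} (g : Set ((Fin m → Bool) × Bool)) : ℝ≥0∞ :=
  ⨆ Q : PMF (PMF (Fin m → Bool) × PMF (Fin m → Bool)), ⨆ _ : Consistent g Q,
    ⨅ T : DecisionTree (Fin m) Bool, ⨅ _ : T.Computes g, conflictExp T Q

end QueryComplexity

/-!
An algorithm for `f ∘ g^n` is turned into one for `f` by drawing, independently for each block, a
pair of distributions `(μ₀, μ₁)` from `𝒬` and simulating the given tree `T`. If `T` queries a bit of
block `i`, then the answers under the two hypotheses on the hidden bit `z i` are coupled maximally.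
If they agree, the simulation goes on without knowing `z i`. Otherwise there is a conflict, `z i` is
queried, and all further queries to the block are answered by its distribution. So block `i`
costs a query with the probability of a conflict in this block.

For a tree computing `g` a conflict is certain, and `χ(T, (μ₀, μ₁))` is the mean number of queries
up to it. The queries of `T` to block `i` before a conflict can be used to start a tree
computing `g`, which then goes on with at most `χ̄(g)` queries on average if there has been no
conflict. Hence the mean number of queries of `T` to block `i` is at least the minimum of
`χ(T', 𝒬)` over the trees `T'` computing `g`, minus `χ̄(g)` times the probability of no conflict;
for near-optimal `𝒬` this is almost `χ̄(g)` times the probability of a conflict. Summation over the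
blocks bounds the mean number of queries for `f`, and by Markov's inequality long runs can be
stopped at the price of a larger error.
-/

namespace QueryComplexity

section Expectation

variable {α β : Type*}

/-- The expectation `∑ₐ w(a) F(a)` of `F` under the weights `w`. The weights need not have total
mass `1`, so that a distribution can be restricted to an event without being renormalized. -/
noncomputable def expect (w : α → ℝ≥0∞) (F : α → ℝ≥0∞) : ℝ≥0∞ := ∑' a, w a * F a

lemma expect_pure (a : α) (F : α → ℝ≥0∞) : expect (PMF.pure a) F = F a := by
  rw [expect, tsum_eq_single a fun b hb => by simp [PMF.pure_apply, hb]]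
  simp

lemma expect_bind (p : PMF α) (q : α → PMF β) (F : β → ℝ≥0∞) :
    expect (p.bind q) F = expect p fun a => expect (q a) F := by
  simp only [expect, PMF.bind_apply, ← ENNReal.tsum_mul_right, ← ENNReal.tsum_mul_left]
  rw [ENNReal.tsum_comm]
  simp only [mul_assoc]

lemma expect_map (p : PMF α) (f : α → β) (F : β → ℝ≥0∞) :
    expect (p.map f) F = expect p fun a => F (f a) := by
  rw [PMF.map, expect_bind]
  exact tsum_congr fun a => congrArg _ (expect_pure _ _)

lemma expect_add (w : α → ℝ≥0∞) (F G : α → ℝ≥0∞) :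
    expect w (fun a => F a + G a) = expect w F + expect w G := by
  simp only [expect, mul_add, ENNReal.tsum_add]

lemma expect_mul_left (w : α → ℝ≥0∞) (c : ℝ≥0∞) (F : α → ℝ≥0∞) :
    expect w (fun a => c * F a) = c * expect w F := by
  simp only [expect, ← ENNReal.tsum_mul_left, mul_left_comm c]

lemma expect_const (p : PMF α) (c : ℝ≥0∞) : expect p (fun _ => c) = c := by
  simp only [expect, ENNReal.tsum_mul_right, p.tsum_coe, one_mul]

lemma expect_mono {w F G : α → ℝ≥0∞} (h : ∀ a, w a ≠ 0 → F a ≤ G a) :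
    expect w F ≤ expect w G := by
  refine ENNReal.tsum_le_tsum fun a => ?_
  by_cases ha : w a = 0
  · simp [ha]
  · exact mul_le_mul_right (h a ha) _

lemma expect_mono_weight {w v : α → ℝ≥0∞} (h : ∀ a, w a ≤ v a) (F : α → ℝ≥0∞) :
    expect w F ≤ expect v F :=
  ENNReal.tsum_le_tsum fun a => mul_le_mul_left (h a) _

lemma expect_congr {w F G : α → ℝ≥0∞} (h : ∀ a, w a ≠ 0 → F a = G a) :
    expect w F = expect w G :=
  (expect_mono fun a ha => (h a ha).le).antisymm (expect_mono fun a ha => (h a ha).ge)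

lemma expect_sum {κ : Type*} (w : α → ℝ≥0∞) (s : Finset κ) (F : κ → α → ℝ≥0∞) :
    expect w (fun a => ∑ k ∈ s, F k a) = ∑ k ∈ s, expect w (F k) := by
  simp only [expect, Finset.mul_sum]
  exact Summable.tsum_finsetSum fun k _ => ENNReal.summable

lemma expect_comm (w : α → ℝ≥0∞) (v : β → ℝ≥0∞) (F : α → β → ℝ≥0∞) :
    expect w (fun a => expect v (F a)) = expect v fun b => expect w fun a => F a b := by
  simp only [expect, ← ENNReal.tsum_mul_left]
  rw [ENNReal.tsum_comm]
  exact tsum_congr fun b => tsum_congr fun a => mul_left_comm _ _ _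

lemma expect_expect_fintype [Fintype β] (w : α → ℝ≥0∞) (v F : α → β → ℝ≥0∞) :
    expect w (fun a => expect (v a) (F a)) =
      ∑ b, expect (fun a => w a * v a b) fun a => F a b := by
  simp only [expect, tsum_fintype, Finset.mul_sum, mul_assoc]
  exact Summable.tsum_finsetSum fun b _ => ENNReal.summable

lemma toOuterMeasure_eq_expect (p : PMF α) (s : Set α) :
    p.toOuterMeasure s = expect p (s.indicator 1) := by
  classical
  rw [PMF.toOuterMeasure_apply, expect]
  simp only [Set.indicator_apply, Pi.one_apply, mul_ite, mul_one, mul_zero]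

end Expectation

section ProductLaw

variable {ι : Type*} [Fintype ι] {α : ι → Type*}

lemma tsum_prod_piSplitAt [DecidableEq ι] (w : ∀ i, α i → ℝ≥0∞) (k : ι) (F : (∀ i, α i) → ℝ≥0∞) :
    ∑' x : ∀ i, α i, (∏ i, w i (x i)) * F x =
      ∑' a, w k a * ∑' y : ∀ j : {j // j ≠ k}, α j,
        (∏ j : {j // j ≠ k}, w j (y j)) * F ((Equiv.piSplitAt k α).symm (a, y)) := by
  rw [← (Equiv.piSplitAt k α).symm.tsum_eq, ENNReal.tsum_prod']
  refine tsum_congr fun a => ?_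
  rw [← ENNReal.tsum_mul_left]
  refine tsum_congr fun y => ?_
  have hk : ((Equiv.piSplitAt k α).symm (a, y)) k = a := by simp
  have hne (j : {j // j ≠ k}) : ((Equiv.piSplitAt k α).symm (a, y)) j = y j := by simp [j.2]
  rw [Fintype.prod_eq_mul_prod_subtype_ne _ k]
  simp only [hk, hne, mul_assoc]

lemma tsum_prod_eq_one {ι : Type*} [Fintype ι] {α : ι → Type*} (P : ∀ i, PMF (α i)) :
    ∑' x : ∀ i, α i, ∏ i, P i (x i) = 1 := by
  classical
  obtain _ | ⟨⟨k⟩⟩ := isEmpty_or_nonempty ι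
  · simp
  · have h := tsum_prod_piSplitAt (fun i => P i) k fun _ => 1
    have := Fintype.card_subtype_lt (p := (· ≠ k)) (x := k) (by simp)
    simpa [tsum_prod_eq_one fun j : {j // j ≠ k} => P j] using h
termination_by Fintype.card ι

/-- The law of independent samples, the `i`-th one drawn from `P i`. -/
noncomputable def productLaw (P : ∀ i, PMF (α i)) : PMF (∀ i, α i) :=
  ⟨fun x => ∏ i, P i (x i), tsum_prod_eq_one P ▸ ENNReal.summable.hasSum⟩

lemma mem_support_of_mem_support_productLaw {P : ∀ i, PMF (α i)} {x : ∀ i, α i}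
    (h : x ∈ (productLaw P).support) (i : ι) : x i ∈ (P i).support :=
  fun h0 => h (Finset.prod_eq_zero (Finset.mem_univ i) h0)

lemma productLaw_eq_bind [DecidableEq ι] (P : ∀ i, PMF (α i)) (k : ι) :
    productLaw P = (P k).bind fun a =>
      (productLaw fun j : {j // j ≠ k} => P j).map fun y => (Equiv.piSplitAt k α).symm (a, y) := by
  ext x
  rw [← PMF.bind_pure (productLaw P)]
  simp only [PMF.map, PMF.bind_apply]
  exact tsum_prod_piSplitAt (fun i => P i) k fun x' => PMF.pure x' x

lemma productLaw_update [DecidableEq ι] (P : ∀ i, PMF (α i)) (k : ι) (ν : PMF (α k)) :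
    productLaw (Function.update P k ν) =
      ν.bind fun a => (productLaw P).map fun x => Function.update x k a := by
  have hsymm (a b : α k) (y : ∀ j : {j // j ≠ k}, α j) :
      Function.update ((Equiv.piSplitAt k α).symm (b, y)) k a =
        (Equiv.piSplitAt k α).symm (a, y) := by
    ext i
    by_cases h : i = k
    · subst h; simp
    · simp [h]
  have hrest : (fun j : {j // j ≠ k} => Function.update P k ν j) =
      fun j : {j // j ≠ k} => P j :=
    funext fun j => Function.update_of_ne j.2 _ _
  rw [productLaw_eq_bind _ k, productLaw_eq_bind P k, hrest, Function.update_self]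
  simp only [PMF.map_bind, PMF.map_comp, Function.comp_def, hsymm, PMF.bind_const]

end ProductLaw

section Conditioning

variable {α β : Type*} (μ : PMF α) {C D : Set α}

lemma toOuterMeasure_univ : μ.toOuterMeasure Set.univ = 1 :=
  (μ.toOuterMeasure_apply_eq_one_iff _).2 (Set.subset_univ _)

lemma toOuterMeasure_ne_top (C : Set α) : μ.toOuterMeasure C ≠ ⊤ :=
  ne_top_of_le_ne_top ENNReal.one_ne_top
    ((μ.toOuterMeasure.mono (Set.subset_univ C)).trans_eq (toOuterMeasure_univ μ))

variable {μ} in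
lemma exists_mem_support_iff : (∃ a ∈ C, a ∈ μ.support) ↔ μ.toOuterMeasure C ≠ 0 := by
  rw [Ne, PMF.toOuterMeasure_apply_eq_zero_iff, disjoint_comm, Set.not_disjoint_iff]

open Classical in
/-- The distribution `μ` conditioned on the event `C`; by convention it is `μ` itself if `C` has
probability `0`. -/
noncomputable def condOn (C : Set α) : PMF α :=
  if h : ∃ a ∈ C, a ∈ μ.support then μ.filter C h else μ

lemma toOuterMeasure_mul_condOn_apply (C : Set α) (a : α) :
    μ.toOuterMeasure C * condOn μ C a = C.indicator μ a := by
  by_cases h : μ.toOuterMeasure C = 0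
  · have hμ : C.indicator μ a = 0 :=
      ENNReal.tsum_eq_zero.1 (μ.toOuterMeasure_apply C ▸ h) a
    rw [h, hμ, zero_mul]
  · rw [condOn, dif_pos (exists_mem_support_iff.2 h), PMF.filter_apply,
      ← PMF.toOuterMeasure_apply, mul_left_comm,
      ENNReal.mul_inv_cancel h (toOuterMeasure_ne_top μ C), mul_one]

lemma support_condOn_subset : (condOn μ C).support ⊆ μ.support := by
  rw [condOn]
  split_ifs with h
  · exact (PMF.support_filter h).trans_subset Set.inter_subset_right
  · rfl

variable {μ} in
lemma support_condOn_subset_of_ne_zero (h : μ.toOuterMeasure C ≠ 0) :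
    (condOn μ C).support ⊆ C := by
  rw [condOn, dif_pos (exists_mem_support_iff.2 h), PMF.support_filter]
  exact Set.inter_subset_left

lemma condOn_univ : condOn μ Set.univ = μ := by
  ext a
  simpa only [toOuterMeasure_univ, one_mul, Set.indicator_univ] using
    toOuterMeasure_mul_condOn_apply μ Set.univ a

lemma toOuterMeasure_mul_indicator_condOn (C D : Set α) (a : α) :
    μ.toOuterMeasure C * D.indicator (condOn μ C) a = (C ∩ D).indicator μ a := by
  rw [Set.inter_comm, ← Set.indicator_indicator]
  by_cases ha : a ∈ D
  · simp only [Set.indicator_of_mem ha, toOuterMeasure_mul_condOn_apply]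
  · simp only [Set.indicator_of_notMem ha, mul_zero]

lemma toOuterMeasure_mul_toOuterMeasure_condOn (C D : Set α) :
    μ.toOuterMeasure C * (condOn μ C).toOuterMeasure D = μ.toOuterMeasure (C ∩ D) := by
  simp only [PMF.toOuterMeasure_apply _ D, PMF.toOuterMeasure_apply _ (C ∩ D),
    ← ENNReal.tsum_mul_left, toOuterMeasure_mul_indicator_condOn]

variable {μ} in
lemma condOn_condOn (h : μ.toOuterMeasure (C ∩ D) ≠ 0) :
    condOn (condOn μ C) D = condOn μ (C ∩ D) := by
  ext a
  rw [← ENNReal.mul_right_inj h (toOuterMeasure_ne_top μ _), toOuterMeasure_mul_condOn_apply,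
    ← toOuterMeasure_mul_toOuterMeasure_condOn, mul_assoc, toOuterMeasure_mul_condOn_apply,
    toOuterMeasure_mul_indicator_condOn]

lemma map_apply_eq_toOuterMeasure (f : α → β) (c : β) :
    (μ.map f) c = μ.toOuterMeasure {a | f a = c} := by
  rw [← PMF.toOuterMeasure_apply_singleton, PMF.toOuterMeasure_map_apply]
  rfl

lemma bind_condOn_fiber (f : α → β) :
    ((μ.map f).bind fun c => condOn μ {a | f a = c}) = μ := by
  ext a
  simp only [PMF.bind_apply, map_apply_eq_toOuterMeasure, toOuterMeasure_mul_condOn_apply]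
  rw [tsum_eq_single (f a) fun c hc => Set.indicator_of_notMem (fun h => hc h.symm) _]
  exact Set.indicator_of_mem (s := {x | f x = f a}) rfl _

end Conditioning

section Coupling

lemma min_add_tsub_self (a b : ℝ≥0∞) : min a b + (a - b) = a := by
  rw [add_comm, tsub_add_min]

lemma sum_bool_fun {M : Type*} [AddCommMonoid M] (w : (Bool → Bool) → M) :
    ∑ a, w a = ∑ c, (w (fun _ => c) + w fun b => c ^^ b) := by
  have hconst (c : Bool) : (Equiv.boolArrowEquivProd Bool).symm (c, c) = fun _ => c := by
    ext b; cases b <;> rfl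
  have hxor (c : Bool) : (Equiv.boolArrowEquivProd Bool).symm (c, !c) = fun b => c ^^ b := by
    ext b; cases b <;> simp [Equiv.boolArrowEquivProd]
  rw [← (Equiv.boolArrowEquivProd Bool).symm.sum_comp, Fintype.sum_prod_type]
  simp only [← hconst, ← hxor, Fintype.sum_bool, Bool.not_true, Bool.not_false]
  rw [add_comm (w ((Equiv.boolArrowEquivProd Bool).symm (false, true)))]

variable (p : Bool → PMF Bool)

lemma sum_pmf_eq_one {α : Type*} [Fintype α] (ν : PMF α) : ∑ a, ν a = 1 := by
  rw [← ν.tsum_coe, tsum_fintype]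

lemma tsub_apply_not (c : Bool) : p true (!c) - p false (!c) = p false c - p true c := by
  have hnot (b : Bool) : p b (!c) = 1 - p b c :=
    ENNReal.eq_sub_of_add_eq ((p b).apply_ne_top c)
      (by cases c <;> simpa [add_comm] using sum_pmf_eq_one (p b))
  rw [hnot, hnot, ENNReal.sub_sub_sub_cancel_left ENNReal.one_ne_top ((p false).coe_le_one c)]

/-- The probability that a maximal coupling of the two bits `p false` and `p true` gives both of
them the value `c`. -/
noncomputable def overlap (c : Bool) : ℝ≥0∞ := min (p false c) (p true c)

/-- The probability that a maximal coupling of the two bits `p false` and `p true` gives them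
different values, that is, the total variation distance of `p false` and `p true`. -/
noncomputable def conflictProb : ℝ≥0∞ := ∑ c, (p false c - p true c)

lemma overlap_le (b c : Bool) : overlap p c ≤ p b c := by
  cases b
  exacts [min_le_left _ _, min_le_right _ _]

lemma expect_overlap_add_conflictProb (c : ℝ≥0∞) :
    expect (overlap p) (fun _ => c) + conflictProb p * c = c := by
  rw [expect, ENNReal.tsum_mul_right, ← add_mul, tsum_fintype, conflictProb,
    ← Finset.sum_add_distrib]
  simp only [overlap, min_add_tsub_self, sum_pmf_eq_one, one_mul]

/-- A maximal coupling of the bits `p false` and `p true`, as the law of a random map `a` for which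
`a b` has law `p b`: the two bits differ with probability `conflictProb p` only. -/
noncomputable def maxCoupling : PMF (Bool → Bool) :=
  PMF.ofFintype
    (fun a => if a false = a true then overlap p (a false)
      else p false (a false) - p true (a false)) <| by
    rw [sum_bool_fun]
    simp [overlap, min_add_tsub_self, ← sum_pmf_eq_one (p false)]

lemma map_maxCoupling (b : Bool) : (maxCoupling p).map (fun a => a b) = p b := by
  ext c
  rw [PMF.map_apply, tsum_fintype, sum_bool_fun]
  have hfalse : overlap p c + (p false c - p true c) = p false c := min_add_tsub_self _ _
  have htrue : overlap p c + (p false (!c) - p true (!c)) = p true c := by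
    rw [← tsub_apply_not, Bool.not_not, overlap, min_comm, min_add_tsub_self]
  cases b
  · rw [← hfalse]
    cases c <;> simp [maxCoupling, add_comm]
  · rw [← htrue]
    cases c <;> simp [maxCoupling, add_comm]

lemma expect_maxCoupling_apply (b : Bool) (F : Bool → ℝ≥0∞) :
    expect (maxCoupling p) (fun a => F (a b)) = expect (p b) F := by
  rw [← map_maxCoupling p b, expect_map]

lemma expect_maxCoupling_ite (F : Bool → ℝ≥0∞) (e : ℝ≥0∞) :
    expect (maxCoupling p) (fun a => if a false = a true then F (a false) else e) =
      expect (overlap p) F + conflictProb p * e := by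
  simp only [expect, tsum_fintype]
  rw [sum_bool_fun, Finset.sum_add_distrib, conflictProb, Finset.sum_mul]
  simp [maxCoupling]

end Coupling

namespace DecisionTree

variable {ι S : Type*}

lemma induction_children {motive : DecisionTree ι S → Prop} (leaf : ∀ s, motive (.leaf s))
    (query : ∀ i t₀ t₁, (∀ c, motive (bif c then t₁ else t₀)) → motive (.query i t₀ t₁))
    (T : DecisionTree ι S) : motive T := by
  induction T with
  | leaf s => exact leaf s
  | query i t₀ t₁ ih₀ ih₁ => exact query i t₀ t₁ (Bool.forall_bool.2 ⟨ih₀, ih₁⟩)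

lemma output_query (i : ι) (t₀ t₁ : DecisionTree ι S) (x : ι → Bool) :
    (query i t₀ t₁).output x = (bif x i then t₁ else t₀).output x := by
  rw [output]
  cases x i <;> rfl

lemma numQueries_query (i : ι) (t₀ t₁ : DecisionTree ι S) (x : ι → Bool) :
    (query i t₀ t₁).numQueries x = 1 + (bif x i then t₁ else t₀).numQueries x := by
  rw [numQueries, add_comm]
  cases x i <;> rfl

end DecisionTree

/-- What is known about a block of bits that hides one bit: the conditional distribution of the
block for either value of the hidden bit. -/
abbrev BlockState (κ : Type*) := Bool → PMF (κ → Bool)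

/-- The law of bit `j` of the block for either value of the hidden bit. -/
noncomputable def BlockState.answers {κ : Type*} (s : BlockState κ) (j : κ) (b : Bool) : PMF Bool :=
  (s b).map fun x => x j

/-- The state after bit `j` of the block has been found to be `c`. -/
noncomputable def BlockState.condition {κ : Type*} (s : BlockState κ) (j : κ) (c : Bool) :
    BlockState κ :=
  fun b => condOn (s b) {x | x j = c}

/-- The state of a simulation of independent blocks, each hiding one bit. -/
abbrev SimState (ι κ : Type*) := ι → BlockState κ

namespace SimState

variable {ι κ : Type*} [DecidableEq ι]

/-- The state after bit `j` of block `i` has been answered by `c` while the hidden bit of the block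
remains unknown. -/
noncomputable def answer (σ : SimState ι κ) (i : ι) (j : κ) (c : Bool) : SimState ι κ :=
  Function.update σ i ((σ i).condition j c)

/-- The state after the hidden bit of block `i` has been found to be `b`, and bit `j` of this block
has been answered by `c`. -/
noncomputable def resolve (σ : SimState ι κ) (i : ι) (j : κ) (b c : Bool) : SimState ι κ :=
  Function.update σ i fun _ => (σ i).condition j c b

lemma answer_self (σ : SimState ι κ) (i : ι) (j : κ) (c : Bool) :
    σ.answer i j c i = (σ i).condition j c :=
  Function.update_self ..

lemma answer_of_ne (σ : SimState ι κ) {i k : ι} (h : k ≠ i) (j : κ) (c : Bool) :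
    σ.answer i j c k = σ k :=
  Function.update_of_ne h ..

lemma answer_apply_congr {σ τ : SimState ι κ} {l : ι} {b : Bool} (h : σ l b = τ l b) (i : ι) (j : κ)
    (c : Bool) : σ.answer i j c l b = τ.answer i j c l b := by
  rcases eq_or_ne l i with rfl | hli
  · simp only [answer_self, BlockState.condition, h]
  · simp only [answer_of_ne _ hli, h]

lemma resolve_of_ne (σ : SimState ι κ) {i k : ι} (h : k ≠ i) (j : κ) (b c : Bool) :
    σ.resolve i j b c k = σ.answer i j c k := by
  rw [answer_of_ne σ h, resolve, Function.update_of_ne h]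

lemma resolve_apply (σ : SimState ι κ) (z : ι → Bool) (i : ι) (j : κ) (c : Bool) (l : ι) :
    σ.resolve i j (z i) c l (z l) = σ.answer i j c l (z l) := by
  rcases eq_or_ne l i with rfl | hli
  · simp only [resolve, answer, Function.update_self]
  · rw [resolve_of_ne σ hli]

end SimState

section InputLaw

variable {ι κ : Type*} [Fintype ι]

/-- The law of the blocks if they are independent and `z` is the vector of the hidden bits. -/
noncomputable def inputLaw (σ : SimState ι κ) (z : ι → Bool) : PMF (ι → κ → Bool) :=
  productLaw fun l => σ l (z l)

lemma inputLaw_congr {σ τ : SimState ι κ} {z : ι → Bool} (h : ∀ l, σ l (z l) = τ l (z l)) :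
    inputLaw σ z = inputLaw τ z :=
  congrArg productLaw (funext h)

variable [DecidableEq ι] (σ : SimState ι κ) (z : ι → Bool) (i : ι) (j : κ)

lemma inputLaw_answer (c : Bool) :
    inputLaw (σ.answer i j c) z =
      (condOn (σ i (z i)) {x | x j = c}).bind fun y =>
        (inputLaw σ z).map fun x => Function.update x i y := by
  refine Eq.trans ?_ (productLaw_update (fun l => σ l (z l)) i _)
  refine congrArg productLaw (funext fun l => ?_)
  rcases eq_or_ne l i with rfl | hli
  · rw [SimState.answer_self, Function.update_self, BlockState.condition]
  · rw [SimState.answer_of_ne σ hli, Function.update_of_ne hli]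

lemma bind_inputLaw_answer :
    (((σ i).answers j (z i)).bind fun c => inputLaw (σ.answer i j c) z) = inputLaw σ z := by
  simp only [inputLaw_answer]
  rw [← PMF.bind_bind, BlockState.answers, bind_condOn_fiber]
  refine (productLaw_update (fun l => σ l (z l)) i _).symm.trans ?_
  rw [Function.update_eq_self i fun l => σ l (z l), inputLaw]

lemma apply_eq_of_mem_support_inputLaw_answer {c : Bool} (hc : (σ i).answers j (z i) c ≠ 0)
    {x : ι → κ → Bool} (hx : x ∈ (inputLaw (σ.answer i j c) z).support) : x i j = c := by
  have hxi := mem_support_of_mem_support_productLaw hx i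
  rw [SimState.answer_self, BlockState.condition] at hxi
  rw [BlockState.answers, map_apply_eq_toOuterMeasure] at hc
  exact support_condOn_subset_of_ne_zero hc hxi

lemma expect_inputLaw (F : Bool → (ι → κ → Bool) → ℝ≥0∞) :
    expect (inputLaw σ z) (fun x => F (x i j) x) =
      expect ((σ i).answers j (z i)) fun c => expect (inputLaw (σ.answer i j c) z) (F c) := by
  rw [← bind_inputLaw_answer σ z i j, expect_bind]
  refine expect_congr fun c hc => expect_congr fun x hx => ?_
  rw [apply_eq_of_mem_support_inputLaw_answer σ z i j hc hx]

end InputLaw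

section Simulation

variable {ι κ S : Type*} [DecidableEq ι]

/-- The simulation of one query to bit `j` of block `i`, going on with `R` after the answer. The
hidden bit `i` is queried only if the maximal coupling of the two possible answers disagrees. -/
noncomputable def simStep (i : ι) (j : κ) (σ : SimState ι κ)
    (R : Bool → SimState ι κ → PMF (DecisionTree ι S)) : PMF (DecisionTree ι S) :=
  (maxCoupling ((σ i).answers j)).bind fun a =>
    if a false = a true then R (a false) (σ.answer i j (a false))
    else (R (a false) (σ.resolve i j false (a false))).bind fun u₀ =>
      (R (a true) (σ.resolve i j true (a true))).map fun u₁ => .query i u₀ u₁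

/-- The simulation of a tree that queries bits of the blocks by a random tree that queries hidden
bits. -/
noncomputable def simulate : DecisionTree (ι × κ) S → SimState ι κ → PMF (DecisionTree ι S)
  | .leaf s, _ => PMF.pure (.leaf s)
  | .query ij t₀ t₁, σ =>
      simStep ij.1 ij.2 σ fun c => bif c then simulate t₁ else simulate t₀

lemma simulate_query (ij : ι × κ) (t₀ t₁ : DecisionTree (ι × κ) S) (σ : SimState ι κ) :
    simulate (.query ij t₀ t₁) σ =
      simStep ij.1 ij.2 σ fun c => simulate (bif c then t₁ else t₀) := by
  simp only [simulate, Bool.apply_cond]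

lemma expect_simStep (i : ι) (j : κ) (σ : SimState ι κ)
    (R : Bool → SimState ι κ → PMF (DecisionTree ι S))
    (F : DecisionTree ι S → ℝ≥0∞) (e : ℝ≥0∞) (b : Bool)
    (hF : ∀ u₀ u₁, F (.query i u₀ u₁) = e + F (bif b then u₁ else u₀)) :
    expect (simStep i j σ R) F = expect (maxCoupling ((σ i).answers j)) fun a =>
      if a false = a true then expect (R (a b) (σ.answer i j (a b))) F
      else e + expect (R (a b) (σ.resolve i j b (a b))) F := by
  rw [simStep, expect_bind]
  refine expect_congr fun a _ => ?_
  split_ifs with h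
  · cases b <;> simp only [h]
  · simp only [expect_bind, expect_map, hF]
    cases b <;> simp [expect_add, expect_const]

variable [Fintype ι]

lemma expect_simulate_output (z : ι → Bool) (F : S → ℝ≥0∞) (T : DecisionTree (ι × κ) S)
    (σ : SimState ι κ) :
    expect (simulate T σ) (fun u => F (u.output z)) =
      expect (inputLaw σ z) fun x => F (T.output (Function.uncurry x)) := by
  induction T using DecisionTree.induction_children generalizing σ with
  | leaf s => simp only [simulate, expect_pure, DecisionTree.output, expect_const]
  | query ij t₀ t₁ ih =>
    obtain ⟨i, j⟩ := ij
    rw [simulate_query, expect_simStep i j σ _ _ 0 (z i)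
      (fun u₀ u₁ => by rw [DecisionTree.output_query, zero_add])]
    simp only [ih, zero_add, inputLaw_congr (fun l => σ.resolve_apply z i j _ l), ite_self]
    rw [expect_maxCoupling_apply ((σ i).answers j) (z i) fun c =>
      expect (inputLaw (σ.answer i j c) z) fun x =>
        F ((bif c then t₁ else t₀).output (Function.uncurry x)), ← expect_inputLaw]
    simp only [DecisionTree.output_query, Function.uncurry_apply_pair]

end Simulation

section ExpectedCharge

variable {ι κ S : Type*} [DecidableEq ι]

/-- The expected total charge of the queries to block `k` up to the first conflict in this block,
if the hidden bits are `z` and a query to bit `j` in state `s` of the block costs `e s j`. -/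
noncomputable def expectedCharge (e : BlockState κ → κ → ℝ≥0∞) (k : ι) (z : ι → Bool) :
    DecisionTree (ι × κ) S → SimState ι κ → ℝ≥0∞
  | .leaf _, _ => 0
  | .query ij t₀ t₁, σ =>
      let rest (c : Bool) : ℝ≥0∞ :=
        (bif c then expectedCharge e k z t₁ else expectedCharge e k z t₀) (σ.answer ij.1 ij.2 c)
      if ij.1 = k then e (σ k) ij.2 + expect (overlap ((σ k).answers ij.2)) rest
      else expect ((σ ij.1).answers ij.2 (z ij.1)) rest

variable (e : BlockState κ → κ → ℝ≥0∞) (z : ι → Bool)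

lemma expectedCharge_query_self (k : ι) (j : κ) (t₀ t₁ : DecisionTree (ι × κ) S)
    (σ : SimState ι κ) :
    expectedCharge e k z (.query (k, j) t₀ t₁) σ =
      e (σ k) j + expect (overlap ((σ k).answers j)) fun c =>
        expectedCharge e k z (bif c then t₁ else t₀) (σ.answer k j c) := by
  rw [expectedCharge, if_pos rfl]
  exact congrArg _ (expect_congr fun c _ => by cases c <;> rfl)

lemma expectedCharge_query_of_ne {i k : ι} (h : k ≠ i) (j : κ) (t₀ t₁ : DecisionTree (ι × κ) S)
    (σ : SimState ι κ) :
    expectedCharge e k z (.query (i, j) t₀ t₁) σ =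
      expect ((σ i).answers j (z i)) fun c =>
        expectedCharge e k z (bif c then t₁ else t₀) (σ.answer i j c) := by
  rw [expectedCharge, if_neg h.symm]
  exact expect_congr fun c _ => by cases c <;> rfl

variable {z}

lemma expectedCharge_congr (k : ι) (T : DecisionTree (ι × κ) S) {σ τ : SimState ι κ}
    (hk : σ k = τ k) (hz : ∀ l, σ l (z l) = τ l (z l)) :
    expectedCharge e k z T σ = expectedCharge e k z T τ := by
  induction T using DecisionTree.induction_children generalizing σ τ with
  | leaf s => rfl
  | query ij t₀ t₁ ih =>
    obtain ⟨i, j⟩ := ij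
    have ih' (c : Bool) : expectedCharge e k z (bif c then t₁ else t₀) (σ.answer i j c) =
        expectedCharge e k z (bif c then t₁ else t₀) (τ.answer i j c) :=
      ih c (funext fun b => SimState.answer_apply_congr (congrFun hk b) i j c)
        fun l => SimState.answer_apply_congr (hz l) i j c
    rcases eq_or_ne k i with rfl | hki
    · simp only [expectedCharge_query_self, hk, ih']
    · simp only [expectedCharge_query_of_ne e z hki, BlockState.answers, hz i, ih']

/-- The probability of a conflict in a query to bit `j` of the block. -/
noncomputable def BlockState.conflictAt (s : BlockState κ) (j : κ) : ℝ≥0∞ :=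
  conflictProb (s.answers j)

lemma BlockState.conflictAt_eq_zero {s : BlockState κ} (h : s false = s true) (j : κ) :
    s.conflictAt j = 0 := by
  simp only [BlockState.conflictAt, conflictProb, BlockState.answers, h, tsub_self,
    Finset.sum_const_zero]

lemma expectedCharge_conflictAt_eq_zero (k : ι) (T : DecisionTree (ι × κ) S) {σ : SimState ι κ}
    (h : σ k false = σ k true) :
    expectedCharge BlockState.conflictAt k z T σ = 0 := by
  induction T using DecisionTree.induction_children generalizing σ with
  | leaf s => rfl
  | query ij t₀ t₁ ih =>
    obtain ⟨i, j⟩ := ij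
    have hans (c : Bool) : σ.answer i j c k false = σ.answer i j c k true := by
      rcases eq_or_ne k i with rfl | hki
      · simp only [SimState.answer_self, BlockState.condition, h]
      · simp only [SimState.answer_of_ne σ hki, h]
    rcases eq_or_ne k i with rfl | hki
    · simp [expectedCharge_query_self, BlockState.conflictAt_eq_zero h, ih _ (hans _), expect]
    · simp [expectedCharge_query_of_ne _ z hki, ih _ (hans _), expect]

variable [Fintype ι] (z)

/-- Resolving the hidden bit `i` prevents further conflicts in block `i` and does not affect the
other blocks. -/
lemma sum_expectedCharge_conflictAt_resolve (T : DecisionTree (ι × κ) S) (σ : SimState ι κ)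
    (i : ι) (j : κ) (c : Bool) :
    ∑ k, expectedCharge BlockState.conflictAt k z T (σ.resolve i j (z i) c) =
      ∑ k ∈ Finset.univ.erase i,
        expectedCharge BlockState.conflictAt k z T (σ.answer i j c) := by
  rw [← Finset.add_sum_erase _ _ (Finset.mem_univ i),
    expectedCharge_conflictAt_eq_zero i T (by simp only [SimState.resolve, Function.update_self]),
    zero_add]
  exact Finset.sum_congr rfl fun k hk => expectedCharge_congr _ k T
    (σ.resolve_of_ne (Finset.ne_of_mem_erase hk) j _ c) fun l => σ.resolve_apply z i j c l

theorem expect_simulate_numQueries (T : DecisionTree (ι × κ) S) (σ : SimState ι κ) :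
    expect (simulate T σ) (fun u => (u.numQueries z : ℝ≥0∞)) =
      ∑ k, expectedCharge BlockState.conflictAt k z T σ := by
  induction T using DecisionTree.induction_children generalizing σ with
  | leaf s => simp [simulate, expect_pure, DecisionTree.numQueries, expectedCharge]
  | query ij t₀ t₁ ih =>
    obtain ⟨i, j⟩ := ij
    rw [simulate_query, expect_simStep i j σ _ _ 1 (z i)
      (fun u₀ u₁ => by rw [DecisionTree.numQueries_query, Nat.cast_add, Nat.cast_one])]
    simp only [ih, sum_expectedCharge_conflictAt_resolve]
    set E : ι → Bool → ℝ≥0∞ := fun k c => expectedCharge BlockState.conflictAt k z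
      (bif c then t₁ else t₀) (σ.answer i j c) with hE
    have hsplit (a : Bool → Bool) :
        (if a false = a true then ∑ k, E k (a (z i))
          else 1 + ∑ k ∈ Finset.univ.erase i, E k (a (z i))) =
        (if a false = a true then E i (a false) else 1) +
          ∑ k ∈ Finset.univ.erase i, E k (a (z i)) := by
      split_ifs with h
      · have ha : a false = a (z i) := by cases z i <;> simp only [h]
        rw [ha, Finset.add_sum_erase _ (fun k => E k (a (z i))) (Finset.mem_univ i)]
      · rfl
    simp only [hE] at hsplit
    simp only [hsplit]
    rw [expect_add, expect_maxCoupling_ite _ fun c => E i c,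
      expect_maxCoupling_apply _ (z i) fun c => ∑ k ∈ Finset.univ.erase i, E k c, expect_sum,
      ← Finset.add_sum_erase _ _ (Finset.mem_univ i), expectedCharge_query_self, mul_one,
      BlockState.conflictAt, add_comm (conflictProb _)]
    refine congrArg _ (Finset.sum_congr rfl fun k hk => ?_)
    rw [expectedCharge_query_of_ne _ z (Finset.ne_of_mem_erase hk)]

theorem sum_expectedCharge_one_le (T : DecisionTree (ι × κ) S) (σ : SimState ι κ) :
    ∑ k, expectedCharge (fun _ _ => 1) k z T σ ≤
      expect (inputLaw σ z) fun x => (T.numQueries (Function.uncurry x) : ℝ≥0∞) := by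
  induction T using DecisionTree.induction_children generalizing σ with
  | leaf s => simp [expectedCharge]
  | query ij t₀ t₁ ih =>
    obtain ⟨i, j⟩ := ij
    set E : ι → Bool → ℝ≥0∞ := fun k c => expectedCharge (fun _ _ => 1) k z
      (bif c then t₁ else t₀) (σ.answer i j c)
    have hcharge (k : ι) : expectedCharge (fun _ _ => 1) k z (.query (i, j) t₀ t₁) σ ≤
        (if k = i then 1 else 0) + expect ((σ i).answers j (z i)) (E k) := by
      split_ifs with hki
      · subst hki
        rw [expectedCharge_query_self]
        gcongr
        exact expect_mono_weight (overlap_le _ (z k)) _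
      · rw [expectedCharge_query_of_ne _ z hki, zero_add]
    calc ∑ k, expectedCharge (fun _ _ => 1) k z (.query (i, j) t₀ t₁) σ
        ≤ ∑ k, ((if k = i then 1 else 0) + expect ((σ i).answers j (z i)) (E k)) :=
          Finset.sum_le_sum fun k _ => hcharge k
      _ = 1 + expect ((σ i).answers j (z i)) fun c => ∑ k, E k c := by
          rw [Finset.sum_add_distrib, Finset.sum_ite_eq', if_pos (Finset.mem_univ i), expect_sum]
      _ ≤ 1 + expect ((σ i).answers j (z i)) fun c => expect (inputLaw (σ.answer i j c) z)
            fun x => ((bif c then t₁ else t₀).numQueries (Function.uncurry x) : ℝ≥0∞) := by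
          gcongr
          exact expect_mono fun c _ => ih c _
      _ = _ := by
          rw [← expect_inputLaw σ z i j]
          simp only [DecisionTree.numQueries_query, Nat.cast_add, Nat.cast_one, expect_add,
            expect_const, Function.uncurry_apply_pair]

end ExpectedCharge

section QueriesToConflict

lemma ofReal_abs_toReal_sub {a b : ℝ≥0∞} (ha : a ≠ ⊤) (hb : b ≠ ⊤) :
    ENNReal.ofReal |a.toReal - b.toReal| = (a - b) + (b - a) := by
  wlog h : a ≤ b generalizing a b
  · rw [abs_sub_comm, add_comm, this hb ha (le_of_not_ge h)]
  · rw [abs_sub_comm, abs_of_nonneg (sub_nonneg.2 (ENNReal.toReal_mono hb h)),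
      ← ENNReal.toReal_sub_of_le h hb, ENNReal.ofReal_toReal (ENNReal.sub_ne_top hb),
      tsub_eq_zero_of_le h, zero_add]

/-- The expected number of queries that a tree makes to a block up to the first conflict. -/
noncomputable def queriesToConflict {κ S : Type*} : DecisionTree κ S → BlockState κ → ℝ≥0∞
  | .leaf _, _ => 0
  | .query j t₀ t₁, s =>
      1 + expect (overlap (s.answers j)) fun c =>
        (bif c then queriesToConflict t₁ else queriesToConflict t₀) (s.condition j c)

lemma queriesToConflict_query {κ S : Type*} (j : κ) (t₀ t₁ : DecisionTree κ S)
    (s : BlockState κ) :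
    queriesToConflict (.query j t₀ t₁) s = 1 + expect (overlap (s.answers j)) fun c =>
      queriesToConflict (bif c then t₁ else t₀) (s.condition j c) := by
  rw [queriesToConflict]
  exact congrArg _ (expect_congr fun c _ => by cases c <;> rfl)

lemma exists_queriesToConflict_le {κ S : Type*} (T : DecisionTree κ S) :
    ∃ d : ℕ, ∀ s, queriesToConflict T s ≤ d := by
  induction T using DecisionTree.induction_children with
  | leaf _ => exact ⟨0, fun _ => by simp [queriesToConflict]⟩
  | query j t₀ t₁ ih =>
    choose d hd using ih
    refine ⟨1 + (d false + d true), fun s => ?_⟩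
    rw [queriesToConflict_query, Nat.cast_add, Nat.cast_one]
    gcongr
    refine (expect_mono_weight (overlap_le _ false) _).trans ?_
    rw [← expect_const (s.answers j false) ((d false + d true : ℕ) : ℝ≥0∞)]
    refine expect_mono fun c _ => (hd c _).trans (Nat.cast_le.2 ?_)
    cases c
    exacts [Nat.le_add_right _ _, Nat.le_add_left _ _]

variable {m : ℕ} (μ : BlockState (Fin m)) {C : Set (Fin m → Bool)}

variable (C) in
lemma conflictSum_eq_mul (T : DecisionTree (Fin m) Bool) (d : ℕ) (r : ℝ) :
    conflictSum (μ false) (μ true) T C d r = r * conflictSum (μ false) (μ true) T C d 1 := by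
  induction T generalizing C d r with
  | leaf _ => exact (mul_zero r).symm
  | query j t₀ t₁ ih₀ ih₁ =>
    simp only [conflictSum]
    rw [ih₀ _ _ (r * _), ih₀ _ _ (1 * _), ih₁ _ _ (r * _), ih₁ _ _ (1 * _)]
    ring

variable (C) in
lemma conflictSum_query (j : Fin m) (t₀ t₁ : DecisionTree (Fin m) Bool) (d : ℕ) :
    conflictSum (μ false) (μ true) (.query j t₀ t₁) C d 1 =
      d * |condProb (μ false) C j false - condProb (μ true) C j false| +
        ∑ c, min (condProb (μ false) C j c) (condProb (μ true) C j c) *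
          conflictSum (μ false) (μ true) (bif c then t₁ else t₀) (C ∩ {x | x j = c}) (d + 1) 1 := by
  simp only [conflictSum, one_mul, mul_one, Fintype.sum_bool]
  rw [conflictSum_eq_mul μ _ t₀, conflictSum_eq_mul μ _ t₁, add_assoc]
  exact congrArg _ (add_comm _ _)

variable (C) in
lemma min_condProb_nonneg (j : Fin m) (c : Bool) :
    0 ≤ min (condProb (μ false) C j c) (condProb (μ true) C j c) :=
  le_min ENNReal.toReal_nonneg ENNReal.toReal_nonneg

variable (C) in
lemma conflictSum_nonneg (T : DecisionTree (Fin m) Bool) (d : ℕ) :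
    0 ≤ conflictSum (μ false) (μ true) T C d 1 := by
  induction T using DecisionTree.induction_children generalizing C d with
  | leaf _ => exact le_rfl
  | query j t₀ t₁ ih =>
    rw [conflictSum_query]
    exact add_nonneg (by positivity) <| Finset.sum_nonneg fun c _ =>
      mul_nonneg (min_condProb_nonneg μ C j c) (ih c _ _)

variable {μ}

lemma condProb_eq_toReal {b : Bool} (h : (μ b).toOuterMeasure C ≠ 0) (j : Fin m) (c : Bool) :
    condProb (μ b) C j c = (BlockState.answers (fun b => condOn (μ b) C) j b c).toReal := by
  rw [BlockState.answers, map_apply_eq_toOuterMeasure, condProb]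
  refine congrArg _ (Eq.trans ?_ (ENNReal.mul_div_cancel_right h (toOuterMeasure_ne_top _ C)))
  rw [mul_comm, toOuterMeasure_mul_toOuterMeasure_condOn]
  rfl

lemma ofReal_min_condProb (h : ∀ b, (μ b).toOuterMeasure C ≠ 0) (j : Fin m) (c : Bool) :
    ENNReal.ofReal (min (condProb (μ false) C j c) (condProb (μ true) C j c)) =
      overlap (BlockState.answers (fun b => condOn (μ b) C) j) c := by
  rw [condProb_eq_toReal (h false), condProb_eq_toReal (h true), ENNReal.ofReal_min,
    ENNReal.ofReal_toReal (PMF.apply_ne_top _ _), ENNReal.ofReal_toReal (PMF.apply_ne_top _ _),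
    overlap]

lemma ofReal_abs_condProb_sub (h : ∀ b, (μ b).toOuterMeasure C ≠ 0) (j : Fin m) :
    ENNReal.ofReal |condProb (μ false) C j false - condProb (μ true) C j false| =
      conflictProb (BlockState.answers (fun b => condOn (μ b) C) j) := by
  rw [condProb_eq_toReal (h false), condProb_eq_toReal (h true),
    ofReal_abs_toReal_sub (PMF.apply_ne_top _ _) (PMF.apply_ne_top _ _), conflictProb,
    Fintype.sum_bool, add_comm]
  exact congrArg (· + _) (tsub_apply_not (BlockState.answers _ j) true)

lemma ofReal_conflictSum_query (h : ∀ b, (μ b).toOuterMeasure C ≠ 0) (j : Fin m)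
    (t₀ t₁ : DecisionTree (Fin m) Bool) (d : ℕ) :
    ENNReal.ofReal (conflictSum (μ false) (μ true) (.query j t₀ t₁) C d 1) =
      conflictProb (BlockState.answers (fun b => condOn (μ b) C) j) * d +
        expect (overlap (BlockState.answers (fun b => condOn (μ b) C) j)) fun c =>
          ENNReal.ofReal (conflictSum (μ false) (μ true) (bif c then t₁ else t₀)
            (C ∩ {x | x j = c}) (d + 1) 1) := by
  have hterm (c : Bool) := mul_nonneg (min_condProb_nonneg μ C j c)
    (conflictSum_nonneg μ (C ∩ {x | x j = c}) (bif c then t₁ else t₀) (d + 1))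
  rw [conflictSum_query, ENNReal.ofReal_add (by positivity) (Finset.sum_nonneg fun c _ => hterm c),
    ENNReal.ofReal_sum_of_nonneg fun c _ => hterm c, ENNReal.ofReal_mul (Nat.cast_nonneg _),
    ENNReal.ofReal_natCast, ofReal_abs_condProb_sub h, mul_comm, expect, tsum_fintype]
  simp only [ENNReal.ofReal_mul (min_condProb_nonneg μ C j _), ofReal_min_condProb h]

lemma toOuterMeasure_inter_ne_zero {j : Fin m} {c : Bool}
    (h : overlap (BlockState.answers (fun b => condOn (μ b) C) j) c ≠ 0)
    (hC : ∀ b, (μ b).toOuterMeasure C ≠ 0) (b : Bool) :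
    (μ b).toOuterMeasure (C ∩ {x | x j = c}) ≠ 0 := by
  rw [← toOuterMeasure_mul_toOuterMeasure_condOn, ← map_apply_eq_toOuterMeasure (condOn (μ b) C)]
  exact mul_ne_zero (hC b) fun h0 => h (le_zero_iff.1 ((overlap_le _ b c).trans_eq h0))

/-- The tree is correct on both distributions, so a conflict occurs before a leaf is reached. Hence
`Δ(v) * R(v)` is the distribution of the vertex at which the first conflict occurs. -/
theorem ofReal_conflictSum (T : DecisionTree (Fin m) Bool) (d : ℕ)
    (hC : ∀ b, (μ b).toOuterMeasure C ≠ 0)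
    (hT : ∀ b, ∀ x ∈ C, x ∈ (μ b).support → T.output x = b) :
    ENNReal.ofReal (conflictSum (μ false) (μ true) T C (d + 1) 1) =
      queriesToConflict T (fun b => condOn (μ b) C) + d := by
  induction T using DecisionTree.induction_children generalizing C d with
  | leaf b =>
    obtain ⟨x, hx, hxμ⟩ := exists_mem_support_iff.2 (hC !b)
    exact absurd (hT _ x hx hxμ).symm (Bool.not_ne_self b)
  | query j t₀ t₁ ih =>
    set s : BlockState (Fin m) := fun b => condOn (μ b) C
    have hchild (c : Bool) (hc : overlap (s.answers j) c ≠ 0) :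
        ENNReal.ofReal (conflictSum (μ false) (μ true) (bif c then t₁ else t₀)
          (C ∩ {x | x j = c}) (d + 1 + 1) 1) =
        queriesToConflict (bif c then t₁ else t₀) (s.condition j c) + ((d + 1 : ℕ) : ℝ≥0∞) := by
      have hC' := toOuterMeasure_inter_ne_zero hc hC
      have hcond : s.condition j c = fun b => condOn (μ b) (C ∩ {x | x j = c}) :=
        funext fun b => condOn_condOn (hC' b)
      rw [hcond]
      refine ih c (d + 1) hC' fun b x hx hxμ => ?_
      rw [← hT b x hx.1 hxμ, DecisionTree.output_query, hx.2]
    rw [ofReal_conflictSum_query hC, expect_congr hchild, expect_add, add_left_comm,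
      add_comm (conflictProb _ * _), expect_overlap_add_conflictProb, queriesToConflict_query]
    push_cast
    ring

end QueriesToConflict

section MaxConflict

lemma exists_output_eq {ι S : Type*} [Finite ι] (F : (ι → Bool) → S) :
    ∃ T : DecisionTree ι S, ∀ x, T.output x = F x := by
  classical
  have hdep (u : Set ι) (hu : u.Finite) : ∀ F : (ι → Bool) → S, DependsOn F u →
      ∃ T : DecisionTree ι S, ∀ x, T.output x = F x := by
    induction u, hu using Set.Finite.induction_on with
    | empty => exact fun F hF => ⟨.leaf (F fun _ => false), fun x => hF fun i hi => hi.elim⟩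
    | @insert i u _ _ ih =>
      intro F hF
      have hupdate (c : Bool) : DependsOn (fun x => F (Function.update x i c)) u :=
        fun x y hxy => hF fun l _ => by
          rcases eq_or_ne l i with rfl | hl
          · simp only [Function.update_self]
          · simp_all
      choose T hT using fun c => ih _ (hupdate c)
      refine ⟨.query i (T false) (T true), fun x => ?_⟩
      have hchild : (bif x i then T true else T false) = T (x i) := by cases x i <;> rfl
      rw [DecisionTree.output_query, hchild, hT, Function.update_eq_self]
  exact hdep _ Set.finite_univ F fun x y h => congrArg F (funext fun i => h i (Set.mem_univ i))

variable {m : ℕ} {g : Set ((Fin m → Bool) × Bool)} {α : Type*}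

lemma exists_computes (hg : IsPartialBooleanFunction g) :
    ∃ T : DecisionTree (Fin m) Bool, T.Computes g := by
  have htotal (x : Fin m → Bool) : ∃ b, (x, b) ∈ g := by
    by_cases hx : x ∈ validInputs g
    · exact hx.elim (fun h => ⟨_, h.1⟩) fun h => ⟨_, h.1⟩
    · exact ⟨_, (hg x hx).1⟩
  choose F hF using htotal
  obtain ⟨T, hT⟩ := exists_output_eq F
  exact ⟨T, fun x => (hT x).symm ▸ hF x⟩

lemma eq_of_mem_preim {x : Fin m → Bool} {b c : Bool} (hx : x ∈ preim g b) (hc : (x, c) ∈ g) :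
    c = b := by
  by_contra h
  exact hx.2 (Bool.eq_not_of_ne h ▸ hc)

/-- The inputs in the support of `s b` are valid inputs on which `g` takes the value `b`. This is
the condition on a pair `(μ₀, μ₁)` in the definition of the max conflict complexity. -/
def BlockState.IsConsistent (s : BlockState (Fin m)) (g : Set ((Fin m → Bool) × Bool)) : Prop :=
  ∀ b, (s b).support ⊆ preim g b

lemma BlockState.IsConsistent.condition {s : BlockState (Fin m)} (hs : s.IsConsistent g)
    (j : Fin m) (c : Bool) : (s.condition j c).IsConsistent g :=
  fun b => (support_condOn_subset _).trans (hs b)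

theorem ofReal_conflict {T : DecisionTree (Fin m) Bool} (hT : T.Computes g)
    {s : BlockState (Fin m)} (hs : s.IsConsistent g) :
    ENNReal.ofReal (conflict T (s false) (s true)) = queriesToConflict T s := by
  have h := ofReal_conflictSum (μ := s) (C := Set.univ) T 0
    (fun b => (toOuterMeasure_univ (s b)).trans_ne one_ne_zero)
    fun b x _ hx => eq_of_mem_preim (hs b hx) (hT x)
  simp only [condOn_univ, Nat.cast_zero, add_zero, zero_add] at h
  exact h

/-- The minimum over the trees computing `g` of the mean number of queries up to a conflict, for a
weighted family of block states. -/
noncomputable def minQueriesToConflict (g : Set ((Fin m → Bool) × Bool)) (r : α → ℝ≥0∞)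
    (s : α → BlockState (Fin m)) : ℝ≥0∞ :=
  ⨅ T : DecisionTree (Fin m) Bool, ⨅ _ : T.Computes g, expect r fun a => queriesToConflict T (s a)

lemma minQueriesToConflict_map {β : Type*} (P : PMF β) (u : β → α)
    (s : α → BlockState (Fin m)) :
    minQueriesToConflict g (P.map u) s = minQueriesToConflict g P fun b => s (u b) := by
  simp only [minQueriesToConflict, expect_map]

lemma iInf_conflictExp {Q : PMF (PMF (Fin m → Bool) × PMF (Fin m → Bool))}
    (hQ : Consistent g Q) :
    ⨅ T : DecisionTree (Fin m) Bool, ⨅ _ : T.Computes g, conflictExp T Q =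
      minQueriesToConflict g Q (Equiv.boolArrowEquivProd _).symm := by
  refine iInf_congr fun T => iInf_congr fun hT => expect_congr fun p hp => ?_
  exact ofReal_conflict hT (s := (Equiv.boolArrowEquivProd _).symm p) <|
    Bool.forall_bool.2 (hQ p hp)

theorem maxConflict_eq_iSup (g : Set ((Fin m → Bool) × Bool)) :
    maxConflict g = ⨆ Q : PMF (BlockState (Fin m)), ⨆ _ : ∀ s ∈ Q.support, s.IsConsistent g,
      minQueriesToConflict g Q id := by
  refine le_antisymm (iSup₂_le fun Q hQ => ?_) (iSup₂_le fun Q hQ => ?_)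
  · refine le_iSup₂_of_le (Q.map (Equiv.boolArrowEquivProd _).symm) (fun s hs => ?_) ?_
    · obtain ⟨p, hp, rfl⟩ := (PMF.mem_support_map_iff _ _ _).1 hs
      exact Bool.forall_bool.2 (hQ p hp)
    · rw [iInf_conflictExp hQ, minQueriesToConflict_map]
      rfl
  · have hcons : Consistent g (Q.map (Equiv.boolArrowEquivProd _)) := fun p hp => by
      obtain ⟨s, hs, rfl⟩ := (PMF.mem_support_map_iff _ _ _).1 hp
      exact ⟨hQ s hs false, hQ s hs true⟩
    refine le_iSup₂_of_le _ hcons ?_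
    rw [iInf_conflictExp hcons, minQueriesToConflict_map]
    simp only [Equiv.symm_apply_apply]
    rfl

lemma maxConflict_ne_top (hg : IsPartialBooleanFunction g) : maxConflict g ≠ ⊤ := by
  obtain ⟨T, hT⟩ := exists_computes hg
  obtain ⟨d, hd⟩ := exists_queriesToConflict_le T
  refine ne_top_of_le_ne_top (ENNReal.natCast_ne_top d) ?_
  rw [maxConflict_eq_iSup]
  refine iSup₂_le fun Q _ => iInf₂_le_of_le T hT ?_
  exact (expect_mono fun s _ => hd s).trans_eq (expect_const Q d)

lemma minQueriesToConflict_le_maxConflict_mul (hg : IsPartialBooleanFunction g)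
    {r : α → ℝ≥0∞} (hr : ∑' a, r a ≠ ⊤) {s : α → BlockState (Fin m)}
    (hs : ∀ a, r a ≠ 0 → (s a).IsConsistent g) :
    minQueriesToConflict g r s ≤ maxConflict g * ∑' a, r a := by
  rcases eq_or_ne (∑' a, r a) 0 with h0 | h0
  · obtain ⟨T, hT⟩ := exists_computes hg
    refine (iInf₂_le T hT).trans ?_
    simp [expect, ENNReal.tsum_eq_zero.1 h0]
  · set P : PMF α := PMF.normalize r h0 hr
    have hP (a : α) : r a = (∑' b, r b) * P a := by
      rw [PMF.normalize_apply, mul_left_comm, ENNReal.mul_inv_cancel h0 hr, mul_one]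
    have hcons : ∀ t ∈ (P.map s).support, t.IsConsistent g := fun t ht => by
      obtain ⟨a, ha, rfl⟩ := (PMF.mem_support_map_iff _ _ _).1 ht
      exact hs a ((PMF.mem_support_normalize_iff h0 hr a).1 ha)
    calc minQueriesToConflict g r s
        = (∑' a, r a) * minQueriesToConflict g (P.map s) id := by
          rw [minQueriesToConflict_map]
          simp only [minQueriesToConflict, ENNReal.mul_iInf_of_ne h0 hr, expect,
            ← ENNReal.tsum_mul_left, ← mul_assoc, ← hP, id]
      _ ≤ (∑' a, r a) * maxConflict g := by
          rw [maxConflict_eq_iSup]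
          gcongr
          exact le_iSup₂_of_le (P.map s) hcons le_rfl
      _ = maxConflict g * ∑' a, r a := mul_comm _ _

lemma minQueriesToConflict_le_query (g : Set ((Fin m → Bool) × Bool)) (r : α → ℝ≥0∞)
    (s : α → BlockState (Fin m)) (j : Fin m) :
    minQueriesToConflict g r s ≤ ∑' a, r a +
      ∑ c, minQueriesToConflict g (fun a => r a * overlap ((s a).answers j) c)
        fun a => (s a).condition j c := by
  rw [← tsub_le_iff_left, Fintype.sum_bool]
  refine ENNReal.le_iInf₂_add_iInf₂ fun T₁ hT₁ T₀ hT₀ => tsub_le_iff_left.2 ?_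
  have hT : (DecisionTree.query j T₀ T₁).Computes g := fun x => by
    rw [DecisionTree.output_query]
    cases x j
    exacts [hT₀ x, hT₁ x]
  refine iInf₂_le_of_le (DecisionTree.query j T₀ T₁) hT (le_of_eq ?_)
  simp only [queriesToConflict_query, expect_add, expect_expect_fintype, Fintype.sum_bool,
    cond_true, cond_false]
  simp only [expect, mul_one]

end MaxConflict

section Exchange

variable {ι S α : Type*} [DecidableEq ι] {m : ℕ} {g : Set ((Fin m → Bool) × Bool)}

lemma SimState.answer_update_self {κ : Type*} (σ : SimState ι κ) (k : ι) (s : BlockState κ) (j : κ)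
    (c : Bool) :
    SimState.answer (Function.update σ k s) k j c = Function.update σ k (s.condition j c) := by
  rw [SimState.answer, Function.update_idem, Function.update_self]

lemma SimState.answer_update_of_ne {κ : Type*} (σ : SimState ι κ) {i k : ι} (h : k ≠ i)
    (s : BlockState κ) (j : κ) (c : Bool) :
    SimState.answer (Function.update σ k s) i j c = Function.update (σ.answer i j c) k s := by
  rw [SimState.answer, SimState.answer, Function.update_of_ne h.symm, Function.update_comm h]

lemma expect_expectedCharge_query_self {κ : Type*} (e : BlockState κ → κ → ℝ≥0∞) (z : ι → Bool)
    (k : ι) (j : κ) (t₀ t₁ : DecisionTree (ι × κ) S) (σ : SimState ι κ) (r : α → ℝ≥0∞)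
    (s : α → BlockState κ) :
    expect r (fun a => expectedCharge e k z (.query (k, j) t₀ t₁) (Function.update σ k (s a))) =
      expect r (fun a => e (s a) j) + ∑ c, expect (fun a => r a * overlap ((s a).answers j) c)
        fun a => expectedCharge e k z (bif c then t₁ else t₀)
          (Function.update σ k ((s a).condition j c)) := by
  simp only [expectedCharge_query_self, Function.update_self, SimState.answer_update_self,
    expect_add, expect_expect_fintype]

lemma expect_expectedCharge_query_of_ne {κ : Type*} (e : BlockState κ → κ → ℝ≥0∞) (z : ι → Bool)
    {i k : ι} (h : k ≠ i) (j : κ) (t₀ t₁ : DecisionTree (ι × κ) S) (σ : SimState ι κ)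
    (r : α → ℝ≥0∞) (s : α → BlockState κ) :
    expect r (fun a => expectedCharge e k z (.query (i, j) t₀ t₁) (Function.update σ k (s a))) =
      expect ((σ i).answers j (z i)) fun c => expect r fun a => expectedCharge e k z
        (bif c then t₁ else t₀) (Function.update (σ.answer i j c) k (s a)) := by
  rw [← expect_comm]
  simp only [expectedCharge_query_of_ne e z h, Function.update_of_ne h.symm,
    SimState.answer_update_of_ne σ h]

lemma expect_conflictAt_add_tsum {κ : Type*} (r : α → ℝ≥0∞) (s : α → BlockState κ) (j : κ) :
    expect r (fun a => (s a).conflictAt j) + ∑ c, ∑' a, r a * overlap ((s a).answers j) c =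
      ∑' a, r a := by
  have h (a : α) : ∑ c, overlap ((s a).answers j) c + (s a).conflictAt j = 1 := by
    simpa [expect, tsum_fintype, BlockState.conflictAt] using
      expect_overlap_add_conflictProb ((s a).answers j) 1
  rw [← Summable.tsum_finsetSum fun _ _ => ENNReal.summable, expect, ← ENNReal.tsum_add]
  refine tsum_congr fun a => ?_
  rw [← Finset.mul_sum, ← mul_add, add_comm, h, mul_one]

lemma minQueriesToConflict_add_le_of_children (r : α → ℝ≥0∞) (s : α → BlockState (Fin m))
    (j : Fin m) {χ : ℝ≥0∞} {A B : Bool → ℝ≥0∞}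
    (h : ∀ c, minQueriesToConflict g (fun a => r a * overlap ((s a).answers j) c)
        (fun a => (s a).condition j c) + χ * A c ≤
      B c + χ * ∑' a, r a * overlap ((s a).answers j) c) :
    minQueriesToConflict g r s + χ * (expect r (fun a => (s a).conflictAt j) + ∑ c, A c) ≤
      ∑' a, r a + ∑ c, B c + χ * ∑' a, r a := by
  set w : Bool → α → ℝ≥0∞ := fun c a => r a * overlap ((s a).answers j) c
  set V : Bool → ℝ≥0∞ := fun c => minQueriesToConflict g (w c) fun a => (s a).condition j c
  have hp : expect r (fun a => (s a).conflictAt j) + ∑ c, ∑' a, w c a = ∑' a, r a :=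
    expect_conflictAt_add_tsum r s j
  set p : ℝ≥0∞ := expect r fun a => (s a).conflictAt j
  calc minQueriesToConflict g r s + χ * (p + ∑ c, A c)
      ≤ ∑' a, r a + ∑ c, V c + χ * (p + ∑ c, A c) := by
        gcongr
        exact minQueriesToConflict_le_query g r s j
    _ = ∑' a, r a + χ * p + ∑ c, (V c + χ * A c) := by
        rw [Finset.sum_add_distrib, ← Finset.mul_sum]
        ring
    _ ≤ ∑' a, r a + χ * p + ∑ c, (B c + χ * ∑' a, w c a) :=
        add_le_add le_rfl (Finset.sum_le_sum fun c _ => h c)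
    _ = ∑' a, r a + ∑ c, B c + χ * (p + ∑ c, ∑' a, w c a) := by
        rw [Finset.sum_add_distrib, ← Finset.mul_sum]
        ring
    _ = ∑' a, r a + ∑ c, B c + χ * ∑' a, r a := by rw [hp]

/-- A tree computing `g` can copy the queries of `T` to block `k` until it reaches a leaf of `T` or
a conflict occurs. From the leaf on, it can go on with at most `maxConflict g` queries on average
in the remaining case of no conflict. -/
theorem minQueriesToConflict_add_le (hg : IsPartialBooleanFunction g) (k : ι) (z : ι → Bool)
    (T : DecisionTree (ι × Fin m) S) (σ : SimState ι (Fin m)) {r : α → ℝ≥0∞}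
    (hr : ∑' a, r a ≠ ⊤) {s : α → BlockState (Fin m)} (hs : ∀ a, r a ≠ 0 → (s a).IsConsistent g) :
    minQueriesToConflict g r s + maxConflict g * expect r (fun a =>
        expectedCharge BlockState.conflictAt k z T (Function.update σ k (s a))) ≤
      expect r (fun a => expectedCharge (fun _ _ => 1) k z T (Function.update σ k (s a))) +
        maxConflict g * ∑' a, r a := by
  induction T using DecisionTree.induction_children generalizing r s σ with
  | leaf _ =>
    simpa [expectedCharge, expect] using minQueriesToConflict_le_maxConflict_mul hg hr hs
  | query ij t₀ t₁ ih =>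
    obtain ⟨i, j⟩ := ij
    rcases eq_or_ne k i with rfl | hki
    · rw [expect_expectedCharge_query_self, expect_expectedCharge_query_self,
        show expect r (fun _ => 1) = ∑' a, r a by simp only [expect, mul_one]]
      refine minQueriesToConflict_add_le_of_children r s j fun c => ?_
      refine ih c σ (ne_top_of_le_ne_top hr (ENNReal.tsum_le_tsum fun a => ?_))
        fun a ha => (hs a (left_ne_zero_of_mul ha)).condition j c
      exact mul_le_of_le_one_right' ((overlap_le _ false c).trans (PMF.coe_le_one _ c))
    · rw [expect_expectedCharge_query_of_ne _ z hki, expect_expectedCharge_query_of_ne _ z hki,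
        ← expect_mul_left, ← expect_const ((σ i).answers j (z i)) (minQueriesToConflict g r s),
        ← expect_const ((σ i).answers j (z i)) (maxConflict g * ∑' a, r a), ← expect_add,
        ← expect_add]
      exact expect_mono fun c _ => ih c _ hr hs

end Exchange

section Truncation

variable {ι S : Type*}

namespace DecisionTree

/-- The tree stopped after `k` queries. If it has not reached a leaf by then, it gives the output of
the leftmost leaf below the vertex it has reached. -/
def truncate : ℕ → DecisionTree ι S → DecisionTree ι S
  | _, .leaf s => .leaf s
  | 0, .query _ t₀ _ => truncate 0 t₀
  | k + 1, .query i t₀ t₁ => .query i (truncate k t₀) (truncate k t₁)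

lemma truncate_succ_query (k : ℕ) (i : ι) (t₀ t₁ : DecisionTree ι S) :
    truncate (k + 1) (.query i t₀ t₁) = .query i (truncate k t₀) (truncate k t₁) :=
  rfl

lemma numQueries_truncate_le (k : ℕ) (T : DecisionTree ι S) (x : ι → Bool) :
    (T.truncate k).numQueries x ≤ k := by
  induction T generalizing k with
  | leaf s => simp [truncate, numQueries]
  | query i t₀ t₁ ih₀ ih₁ =>
    cases k with
    | zero => exact ih₀ 0
    | succ k =>
      rw [truncate_succ_query, numQueries]
      split_ifs
      exacts [Nat.succ_le_succ (ih₁ k), Nat.succ_le_succ (ih₀ k)]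

lemma output_truncate {k : ℕ} {T : DecisionTree ι S} {x : ι → Bool} (h : T.numQueries x ≤ k) :
    (T.truncate k).output x = T.output x := by
  induction T generalizing k with
  | leaf s => simp [truncate]
  | query i t₀ t₁ ih₀ ih₁ =>
    cases k with
    | zero => simp [numQueries] at h
    | succ k =>
      rw [numQueries, Nat.succ_le_succ_iff] at h
      rw [truncate_succ_query, output, output]
      split_ifs at h ⊢
      exacts [ih₁ h, ih₀ h]

end DecisionTree

lemma randQueryComplexity_le_of_expect_le {f : Set ((ι → Bool) × S)} {ε γ : ℝ} (hγ : 0 ≤ γ)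
    {B : RandomizedAlgorithm ι S} (hB : ComputesWithError B f ε) (k : ℕ)
    (hk : ∀ x, expect B (fun T => (T.numQueries x : ℝ≥0∞)) ≤ ENNReal.ofReal γ * (k + 1)) :
    randQueryComplexity (ε + γ) f ≤ k := by
  refine sInf_le ⟨B.map (DecisionTree.truncate k), fun x => ?_, fun T hT x => ?_⟩
  · set L : Set (DecisionTree ι S) := {T | k < T.numQueries x}
    have hmarkov : B.toOuterMeasure L ≤ ENNReal.ofReal γ := by
      have h : (k + 1 : ℝ≥0∞) * B.toOuterMeasure L ≤ (k + 1) * ENNReal.ofReal γ := by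
        rw [toOuterMeasure_eq_expect, ← expect_mul_left, mul_comm _ (ENNReal.ofReal γ)]
        refine (expect_mono fun T _ => ?_).trans (hk x)
        by_cases hT : T ∈ L
        · rw [Set.indicator_of_mem hT, Pi.one_apply, mul_one]
          exact_mod_cast Nat.succ_le_of_lt hT
        · simp [Set.indicator_of_notMem hT]
      exact (ENNReal.mul_le_mul_iff_right (by simp) (by finiteness)).1 h
    have hsub : {T : DecisionTree ι S | (x, T.output x) ∈ f} ⊆
        DecisionTree.truncate k ⁻¹' {T | (x, T.output x) ∈ f} ∪ L := by
      intro T hT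
      refine or_iff_not_imp_right.2 fun hL => ?_
      simpa only [Set.mem_preimage, Set.mem_ofPred_eq,
        DecisionTree.output_truncate (not_lt.1 hL)] using hT
    rw [← sub_sub, ENNReal.ofReal_sub _ hγ, tsub_le_iff_right, PMF.toOuterMeasure_map_apply]
    calc ENNReal.ofReal (1 - ε) ≤ B.toOuterMeasure {T | (x, T.output x) ∈ f} := hB x
      _ ≤ B.toOuterMeasure (DecisionTree.truncate k ⁻¹' {T | (x, T.output x) ∈ f} ∪ L) :=
        MeasureTheory.measure_mono hsub
      _ ≤ _ + B.toOuterMeasure L := MeasureTheory.measure_union_le _ _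
      _ ≤ _ + ENNReal.ofReal γ := by gcongr
  · obtain ⟨T, -, rfl⟩ := (PMF.mem_support_map_iff _ _ _).1 hT
    exact_mod_cast T.numQueries_truncate_le k x

lemma ofReal_mul_randQueryComplexity_le {f : Set ((ι → Bool) × S)} {ε γ : ℝ} (hγ : 0 ≤ γ)
    {B : RandomizedAlgorithm ι S} (hB : ComputesWithError B f ε) :
    ENNReal.ofReal γ * (randQueryComplexity (ε + γ) f : ℝ≥0∞) ≤
      ⨆ x, expect B fun T => (T.numQueries x : ℝ≥0∞) := by
  by_contra! h
  have hlt : ∃ k : ℕ, (k : ℕ∞) < randQueryComplexity (ε + γ) f ∧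
      ⨆ x, expect B (fun T => (T.numQueries x : ℝ≥0∞)) ≤ ENNReal.ofReal γ * (k + 1) := by
    generalize randQueryComplexity (ε + γ) f = R at h ⊢
    induction R with
    | top =>
      have hγ0 : ENNReal.ofReal γ ≠ 0 := left_ne_zero_of_mul h.ne_bot
      obtain ⟨k, hk⟩ := ENNReal.exists_nat_mul_gt hγ0 h.ne_top
      refine ⟨k, ENat.natCast_lt_top k, hk.le.trans ?_⟩
      rw [mul_comm]
      gcongr
      exact le_self_add
    | coe R =>
      obtain ⟨k, rfl⟩ := Nat.exists_eq_succ_of_ne_zero (n := R) <| by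
        rintro rfl
        simp at h
      exact ⟨k, by exact_mod_cast k.lt_succ_self, by simpa using h.le⟩
  obtain ⟨k, hkR, hk⟩ := hlt
  exact hkR.not_ge <|
    randQueryComplexity_le_of_expect_le hγ hB k fun x => (le_iSup _ x).trans hk

end Truncation

section Composition

variable {n m : ℕ} {S : Type*} {f : Set ((Fin n → Bool) × S)} {g : Set ((Fin m → Bool) × Bool)}

lemma mem_compose_iff {x : Fin n × Fin m → Bool} {z : Fin n → Bool}
    (hx : ∀ i, block x i ∈ preim g (z i)) (s : S) : (x, s) ∈ compose f g ↔ (z, s) ∈ f := by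
  refine ⟨?_, fun h => Or.inr ⟨z, hx, h⟩⟩
  rintro (⟨i, hi⟩ | ⟨w, hw, hwf⟩)
  · refine absurd ?_ hi
    cases hz : z i
    exacts [Or.inl (hz ▸ hx i), Or.inr (hz ▸ hx i)]
  · rwa [show w = z from funext fun i => eq_of_mem_preim (hx i) (hw i).1] at hwf

/-- The algorithm obtained from `A` by simulating its queries to the blocks, where the initial
states of the blocks are drawn independently from `Q`. -/
noncomputable def simulateIid (A : RandomizedAlgorithm (Fin n × Fin m) S)
    (Q : PMF (BlockState (Fin m))) : RandomizedAlgorithm (Fin n) S :=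
  A.bind fun T => (productLaw fun _ => Q).bind (simulate T)

lemma computesWithError_simulateIid {ε : ℝ} {A : RandomizedAlgorithm (Fin n × Fin m) S}
    (hA : ComputesWithError A (compose f g) ε) {Q : PMF (BlockState (Fin m))}
    (hQ : ∀ s ∈ Q.support, s.IsConsistent g) : ComputesWithError (simulateIid A Q) f ε := by
  intro z
  set F : S → ℝ≥0∞ := {s | (z, s) ∈ f}.indicator 1
  have hoptimal (σ : SimState (Fin n) (Fin m)) (hσ : σ ∈ (productLaw fun _ => Q).support) :
      ENNReal.ofReal (1 - ε) ≤
        expect (inputLaw σ z) fun x => expect A fun T => F (T.output (Function.uncurry x)) := by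
    rw [← expect_const (inputLaw σ z) (ENNReal.ofReal (1 - ε))]
    refine expect_mono fun x hx => ?_
    have hvalid (i : Fin n) : block (Function.uncurry x) i ∈ preim g (z i) :=
      hQ _ (mem_support_of_mem_support_productLaw hσ i) _
        (mem_support_of_mem_support_productLaw hx i)
    refine (hA (Function.uncurry x)).trans_eq ?_
    simp only [toOuterMeasure_eq_expect, mem_compose_iff hvalid]
    rfl
  calc ENNReal.ofReal (1 - ε)
      ≤ expect (productLaw fun _ => Q) fun σ => expect (inputLaw σ z) fun x =>
          expect A fun T => F (T.output (Function.uncurry x)) := by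
        rw [← expect_const (productLaw fun _ : Fin n => Q) (ENNReal.ofReal (1 - ε))]
        exact expect_mono hoptimal
    _ = expect A fun T => expect (productLaw fun _ => Q) fun σ =>
          expect (simulate T σ) fun u => F (u.output z) := by
        simp only [expect_simulate_output, expect_comm _ A]
    _ = (simulateIid A Q).toOuterMeasure {u | (z, u.output z) ∈ f} := by
        rw [toOuterMeasure_eq_expect, simulateIid]
        simp only [expect_bind]
        rfl

lemma minQueriesToConflict_add_le_productLaw (hg : IsPartialBooleanFunction g)
    {Q : PMF (BlockState (Fin m))} (hQ : ∀ s ∈ Q.support, s.IsConsistent g)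
    (T : DecisionTree (Fin n × Fin m) S) (z : Fin n → Bool) (k : Fin n) :
    minQueriesToConflict g Q id + maxConflict g *
        expect (productLaw fun _ => Q) (expectedCharge BlockState.conflictAt k z T) ≤
      expect (productLaw fun _ => Q) (expectedCharge (fun _ _ => 1) k z T) + maxConflict g := by
  have hresample (e : BlockState (Fin m) → Fin m → ℝ≥0∞) :
      expect (productLaw fun _ => Q) (expectedCharge e k z T) =
        expect (productLaw fun _ => Q) fun σ =>
          expect Q fun s => expectedCharge e k z T (Function.update σ k s) := by
    conv_lhs =>
      rw [← Function.update_eq_self k fun _ => Q, productLaw_update, expect_bind]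
      simp only [expect_map]
    exact expect_comm ..
  have hstep := expect_mono (w := productLaw fun _ => Q) fun σ _ =>
    minQueriesToConflict_add_le hg k z T σ Q.tsum_coe_ne_top (s := id) hQ
  simpa only [expect_add, expect_const, expect_mul_left, Q.tsum_coe, mul_one, id, ← hresample]
    using hstep

lemma mul_minQueriesToConflict_add_le (hg : IsPartialBooleanFunction g)
    {Q : PMF (BlockState (Fin m))} (hQ : ∀ s ∈ Q.support, s.IsConsistent g)
    {A : RandomizedAlgorithm (Fin n × Fin m) S} {q : ℕ∞}
    (hq : ∀ T ∈ A.support, ∀ x, (T.numQueries x : ℕ∞) ≤ q) (z : Fin n → Bool) :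
    n * minQueriesToConflict g Q id + maxConflict g *
        expect (simulateIid A Q) (fun u => (u.numQueries z : ℝ≥0∞)) ≤
      q + n * maxConflict g := by
  rw [simulateIid, expect_bind, ← expect_mul_left,
    ← expect_const A (n * minQueriesToConflict g Q id),
    ← expect_const A (q + n * maxConflict g), ← expect_add]
  refine expect_mono fun T hT => ?_
  have hsum := Finset.sum_le_sum fun k (_ : k ∈ Finset.univ) =>
    minQueriesToConflict_add_le_productLaw hg hQ T z k
  simp only [Finset.sum_add_distrib, ← Finset.mul_sum, ← expect_sum, Finset.sum_const,
    Finset.card_univ, Fintype.card_fin, nsmul_eq_mul] at hsum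
  simp only [expect_bind, expect_simulate_numQueries]
  refine hsum.trans (add_le_add_left ?_ _)
  rw [← expect_const (productLaw fun _ : Fin n => Q) (q : ℝ≥0∞)]
  refine expect_mono fun σ _ => (sum_expectedCharge_one_le z T σ).trans ?_
  rw [← expect_const (inputLaw σ z) (q : ℝ≥0∞)]
  exact expect_mono fun x _ => by exact_mod_cast ENat.toENNReal_le.2 (hq T hT _)

theorem ofReal_mul_randQueryComplexity_mul_maxConflict_le (hg : IsPartialBooleanFunction g)
    {ε γ : ℝ} (hγ : 0 ≤ γ) {A : RandomizedAlgorithm (Fin n × Fin m) S}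
    (hA : ComputesWithError A (compose f g) ε) {q : ℕ∞}
    (hq : ∀ T ∈ A.support, ∀ x, (T.numQueries x : ℕ∞) ≤ q) :
    ENNReal.ofReal γ * (randQueryComplexity (ε + γ) f * maxConflict g) ≤ q := by
  set χ := maxConflict g
  set ρ := ENNReal.ofReal γ * randQueryComplexity (ε + γ) f
  have hQ (Q : {Q : PMF (BlockState (Fin m)) // ∀ s ∈ Q.support, s.IsConsistent g}) :
      χ * ρ + n * minQueriesToConflict g Q id ≤ q + n * χ := by
    calc χ * ρ + n * minQueriesToConflict g Q id
        ≤ χ * (⨆ z, expect (simulateIid A Q) fun u => (u.numQueries z : ℝ≥0∞)) +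
            n * minQueriesToConflict g Q id := by
          gcongr
          exact ofReal_mul_randQueryComplexity_le hγ (computesWithError_simulateIid hA Q.2)
      _ ≤ q + n * χ := by
          rw [ENNReal.mul_iSup, add_comm, ENNReal.add_iSup]
          exact iSup_le (mul_minQueriesToConflict_add_le hg Q.2 hq)
  have hχ : χ = ⨆ Q : {Q : PMF (BlockState (Fin m)) // ∀ s ∈ Q.support, s.IsConsistent g},
      minQueriesToConflict g Q id :=
    (maxConflict_eq_iSup g).trans iSup_subtype'
  rw [← mul_assoc, mul_comm]
  rcases isEmpty_or_nonempty
    {Q : PMF (BlockState (Fin m)) // ∀ s ∈ Q.support, s.IsConsistent g}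
  · simp [hχ]
  · have hcancel : χ * ρ + n * χ ≤ q + n * χ := by
      conv_lhs => rw [hχ, ENNReal.mul_iSup, ← hχ, ENNReal.add_iSup]
      exact iSup_le hQ
    have hfin : n * χ ≠ ⊤ :=
      ENNReal.mul_ne_top (ENNReal.natCast_ne_top n) (maxConflict_ne_top hg)
    exact (ENNReal.add_le_add_iff_right hfin).1 hcancel

end Composition

lemma exists_computesWithError_of_ne_top {ι S : Type*} {h : Set ((ι → Bool) × S)} {ε : ℝ}
    (hR : randQueryComplexity ε h ≠ ⊤) :
    ∃ A : RandomizedAlgorithm ι S, ComputesWithError A h ε ∧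
      ∀ T ∈ A.support, ∀ x, (T.numQueries x : ℕ∞) ≤ randQueryComplexity ε h :=
  csInf_mem <| Set.nonempty_iff_ne_empty.2 fun hempty => hR <|
    (congrArg sInf hempty).trans sInf_empty

end QueryComplexity

open QueryComplexity in
theorem theorem2_general {n m : ℕ} {S : Type*} {f : Set ((Fin n → Bool) × S)}
    {g : Set ((Fin m → Bool) × Bool)} (hg : IsPartialBooleanFunction g) (ε : ℝ) {γ : ℝ}
    (hγ : 0 ≤ γ) :
    ENNReal.ofReal γ * ((randQueryComplexity (ε + γ) f : ℝ≥0∞) * maxConflict g) ≤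
      (randQueryComplexity ε (compose f g) : ℝ≥0∞) := by
  rcases eq_or_ne (randQueryComplexity ε (compose f g)) ⊤ with htop | htop
  · rw [htop]
    exact le_top
  · obtain ⟨A, hA, hq⟩ := exists_computesWithError_of_ne_top htop
    exact ofReal_mul_randQueryComplexity_mul_maxConflict_le hg hγ hA hq

theorem theorem2 :
    ∃ c : ℝ, 0 < c ∧
      ∀ (n m : ℕ) (S : Type*) (f : Set ((Fin n → Bool) × S)) (g : Set ((Fin m → Bool) × Bool)),
        QueryComplexity.IsPartialBooleanFunction g →
        ENNReal.ofReal c *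
            ((QueryComplexity.randQueryComplexity (4 / 9) f : ℝ≥0∞) *
              QueryComplexity.maxConflict g) ≤
          (QueryComplexity.randQueryComplexity (1 / 3) (QueryComplexity.compose f g) : ℝ≥0∞) := by
  refine ⟨1 / 9, by norm_num, fun n m S f g hg => ?_⟩
  simpa only [show (1 / 3 + 1 / 9 : ℝ) = 4 / 9 by norm_num] using
    theorem2_general (f := f) hg (1 / 3) (γ := 1 / 9) (by norm_num)
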